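/- Let $m,n\in\mathbb N$, $d=m+n$, and let $T\subseteq\mathbb R_-^m\times\mathbb R^n$ be a production set (inputs are counted negatively) such that: (T1) $0\in T$, and $(0,y)\notin T$ whenever $y\ge 0$, $y\neq 0$; (T2) for every $z\in T$ the set $T_z=\{u\in T: u\ge z\}$ is bounded; (T3) $T$ is closed; (T4) if $z\in T$ and $z'\le z$, then $z'\in T$. Let $z\in T$ and $g\in\mathbb R_+^d\setminus\{0\}$, and put $K_g=\{k: g_k\neq 0\}$, $d_g=|K_g|$. For real $r\neq0$ and nonnegative $(\delta_k)_{k\in K_g}$ let $S_r(\delta)=\big(\sum_{k\in K_g}\delta_k^{\,r}\big)^{1/r}$, with $S_r(\delta)=0$ if $r<0$ and $\min_{k\in K_g}\delta_k=0$. With $\odot$ the componentwise product, define $$D_{(p)}(z;g)=\sup\big\{d_g^{-1/p}S_p(\delta):\delta\in\mathbb R_+^d,\ z+\delta\odot g\in T\big\}\quad(p\in\mathbb R\setminus\{0\}),$$ $$D_{(0)}(z;g)=\sup\Big\{\prod_{k\in K_g}\delta_k^{1/d_g}:\delta\in\mathbb R_+^d,\ z+\delta\odot g\in T\Big\},\qquad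 D_{FL}(z;g)=\sup\Big\{\tfrac1{d_g}\sum_{k\in K_g}\delta_k:\delta\in\mathbb R_+^d,\ z+\delta\odot g\in T\Big\},$$ $$D(z;g)=\sup\{\delta\in\mathbb R: z+\delta g\in T\}\ (\text{the case }p=-\infty),\qquad AD(z;g)=\max_{k\in K_g}D(z;g_ke_k)\ (\text{the case }p=\infty),$$ where $e_k$ is the $k$-th canonical basis vector, and, for $w\in\mathbb R_+^d$, the profit functions $$\Pi_z(w)=\sup\{w\cdot u:u\in T_z\},\qquad \Pi_{z,g}(w)=\sup\{w\cdot u:u\in T_z,\ u_k=z_k\text{ for all }k\notin K_g\}.$$ Then, with $w$ ranging over $\mathbb R_+^d$: (a) for all real $p>1$, with $\frac1p+\frac1q=1$, $$D_{(p)}(z;g)=\sup_{w\ge0}\Big\{\Pi_{z,g}(w)-w\cdot z:\ d_g^{\frac{q-1}{q}}\Big(\sum_{k\in K_g}(g_kw_k)^q\Big)^{1/q}=1\Big\};$$ (b) for $p=1$, $$D_{(1)}(z;g)=D_{FL}(z;g)=\sup_{w\ge0}\Big\{\Pi_{z,g}(w)-w\cdot z:\ d_g\max_{k\in K_g}w_kg_k=1\Big\};$$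 (c) for $p=\infty$, $$AD(z;g)=\sup_{w\ge0}\{\Pi_{z,g}(w)-w\cdot z:\ w\cdot g=1\}.$$ If moreover (T5) $T$ is convex, then: (d) for $p=0$, $$D_{(0)}(z;g)=\inf_{w\ge0}\Big\{\Pi_z(w)-w\cdot z:\ d_g\prod_{k\in K_g}(g_kw_k)^{1/d_g}=1\Big\};$$ (e) for all real $p<1$, $p\ne0$, with $\frac1p+\frac1q=1$, $$D_{(p)}(z;g)=\inf_{w\ge0}\Big\{\Pi_z(w)-w\cdot z:\ d_g^{\frac{q-1}{q}}\,S_q\big((g_kw_k)_{k\in K_g}\big)=1\Big\};$$ (f) for $p=-\infty$, $$D(z;g)=\inf_{w\ge0}\{\Pi_z(w)-w\cdot z:\ w\cdot g=1\}.$$ -/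

import Mathlib

namespace NetputDuality

/-- Netput vectors with `m` inputs (left summand) and `n` outputs (right summand). -/
abbrev Netput (m n : ℕ) : Type := Fin m ⊕ Fin n → ℝ

/-- The netputs of `T` that dominate `z`. -/
def dominating {m n : ℕ} (T : Set (Netput m n)) (z : Netput m n) : Set (Netput m n) :=
  {u | u ∈ T ∧ z ≤ u}

/-- The standing assumptions on a production set `T ⊆ ℝ₋^m × ℝ^n`: inaction is possible and there
is no free lunch (T1), the dominating sets are bounded (T2), `T` is closed (T3), and netputs are
freely disposable (T4). -/
structure IsTechnology {m n : ℕ} (T : Set (Netput m n)) : Prop where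
  input_nonpos : ∀ z ∈ T, ∀ i : Fin m, z (Sum.inl i) ≤ 0
  zero_mem : (0 : Netput m n) ∈ T
  no_free_lunch : ∀ y : Fin n → ℝ, 0 ≤ y → y ≠ 0 → (Sum.elim 0 y : Netput m n) ∉ T
  bounded : ∀ z ∈ T, Bornology.IsBounded (dominating T z)
  closed : IsClosed T
  free_disposal : ∀ z ∈ T, ∀ z' : Netput m n, z' ≤ z → z' ∈ T

/-- The support `K_g` of a direction `g`. -/
noncomputable def supp {m n : ℕ} (g : Netput m n) : Finset (Fin m ⊕ Fin n) :=
  Finset.univ.filter fun k => g k ≠ 0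

theorem supp_nonempty {m n : ℕ} {g : Netput m n} (hg : g ≠ 0) : (supp g).Nonempty := by
  obtain ⟨k, hk⟩ := Function.ne_iff.mp hg
  exact ⟨k, by simpa [supp] using hk⟩

/-- The number `d_g` of elements of the support of `g`. -/
noncomputable def suppCard {m n : ℕ} (g : Netput m n) : ℝ := ((supp g).card : ℝ)

open Classical in
/-- The `φ_p`-generalized sum over `K` of the nonnegative family `δ`, for `p ≠ 0`: it is
`(∑ δ_k ^ p) ^ (1 / p)`, where for `p < 0` the value is `0` as soon as some `δ_k` vanishes. -/
noncomputable def phiSum {ι : Type*} (p : ℝ) (K : Finset ι) (δ : ι → ℝ) : ℝ :=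
  if p < 0 ∧ ∃ k ∈ K, δ k = 0 then 0 else (∑ k ∈ K, δ k ^ p) ^ (1 / p)

/-- The directional distance function `D(z; g)`. -/
noncomputable def directionalDist {m n : ℕ} (T : Set (Netput m n)) (z g : Netput m n) : EReal :=
  ⨆ (δ : ℝ) (_ : z + δ • g ∈ T), (δ : EReal)

/-- The asymmetric directional distance function `AD(z; g)`. -/
noncomputable def asymmetricDist {m n : ℕ} (T : Set (Netput m n)) (z g : Netput m n) : EReal :=
  ⨆ k ∈ supp g, directionalDist T z (Pi.single k (g k))

open Classical in
/-- For an aggregator `A` of nonnegative vectors, the supremum of `A δ` over the `δ ≥ 0` such that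
`z + δ ⊙ g ∈ T`; it is `-∞` if `z ∉ T`, and `+∞` if `z ∈ T` and `g = 0`. -/
noncomputable def slackDist {m n : ℕ} (A : Netput m n → ℝ) (T : Set (Netput m n))
    (z g : Netput m n) : EReal :=
  if z ∉ T then ⊥ else if g = 0 then ⊤ else
    ⨆ (δ : Netput m n) (_ : 0 ≤ δ) (_ : z + δ * g ∈ T), (A δ : EReal)

/-- The generalized directional Färe–Lovell distance function `D_(p)(z; g)`, for `p ≠ 0`. -/
noncomputable def genDist {m n : ℕ} (p : ℝ) (T : Set (Netput m n)) (z g : Netput m n) : EReal :=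
  slackDist (fun δ => 1 / suppCard g ^ (1 / p) * phiSum p (supp g) δ) T z g

/-- The directional Färe–Lovell distance function `D_FL(z; g)`. -/
noncomputable def fareLovellDist {m n : ℕ} (T : Set (Netput m n)) (z g : Netput m n) : EReal :=
  slackDist (fun δ => 1 / suppCard g * ∑ k ∈ supp g, δ k) T z g

/-- The multiplicative directional Färe–Lovell distance function `D_(0)(z; g)`. -/
noncomputable def multDist {m n : ℕ} (T : Set (Netput m n)) (z g : Netput m n) : EReal :=
  slackDist (fun δ => ∏ k ∈ supp g, δ k ^ (1 / suppCard g)) T z g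

/-- The profit function `Π_z(w)`, restricted to the netputs that dominate `z`. -/
noncomputable def profit {m n : ℕ} (T : Set (Netput m n)) (z w : Netput m n) : EReal :=
  ⨆ u ∈ dominating T z, ((w ⬝ᵥ u : ℝ) : EReal)

/-- The profit function `Π_{z,g}(w)`: in addition, the netputs outside the support of `g` are kept
at their levels in `z`. -/
noncomputable def profitDir {m n : ℕ} (T : Set (Netput m n)) (z g w : Netput m n) : EReal :=
  ⨆ (u : Netput m n) (_ : u ∈ dominating T z) (_ : ∀ k, k ∉ supp g → u k = z k),
    ((w ⬝ᵥ u : ℝ) : EReal)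

end NetputDuality

open NetputDuality

/-! Writing `u = z + δ ⊙ g` turns `w·u - w·z` into the linear form `∑ g_k w_k δ_k` over feasible
slacks, so each formula compares an aggregator of slacks with a family of linear forms.

For `p ≥ 1` (and `p = ∞`) the aggregator is a multiple of a norm, hence a maximum of linear forms
over normalized weights: Hölder and its equality case for finite `p > 1`. Two suprema commute, so
convexity of `T` plays no role (`slackDist_eq_iSup`).

For `p < 1` the aggregator is a minimum of linear forms, by reverse Hölder or AM-GM, which gives
weak duality. Equality needs a minimax argument and convexity. A maximizer `y` of `∑ h(y_k + ε)`
over the compact convex slack set, with `h' = x^(p-1)`, is supported by the weights `(y_k +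
ε)^(p-1)`; normalized, these are exactly the minimizing weights at `y + ε`. The shift avoids the
singularity at zero, and its cost vanishes with `ε` (`exists_power_support`, `slackDist_eq_iInf`).
For `p = -∞` the aggregator is a minimum of coordinates, and separation from an orthant replaces the
gradient (`exists_weight_of_no_dominating`). -/

namespace NetputDuality

open Finset Filter Topology

/-! ### Power means: Hölder inequalities, continuity, supporting weights -/

section Aggregators

variable {ι : Type*}

/-- Hölder's inequality for exponents below one, one of which is negative. -/
theorem reverse_holder {K : Finset ι} {p q : ℝ} (hq : 0 < q) (hq1 : q < 1)
    (hpq : 1 / p + 1 / q = 1) {a b : ι → ℝ} (ha : ∀ k ∈ K, 0 ≤ a k) (hb : ∀ k ∈ K, 0 < b k)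
    (hK : K.Nonempty) :
    (∑ k ∈ K, b k ^ p) ^ (1 / p) * (∑ k ∈ K, a k ^ q) ^ (1 / q) ≤ ∑ k ∈ K, a k * b k := by
  have hq' : 1 - q ≠ 0 := by linarith
  have hp : p = -q / (1 - q) := by
    have h1 : 1 / p = (q - 1) / q := by field_simp at hpq ⊢; linarith
    have h2 : p = q / (q - 1) := by rw [← one_div_one_div p, h1, one_div_div]
    rw [h2, neg_div, ← div_neg]; congr 1; ring
  have hconj : (1 / q).HolderConjugate (1 / (1 - q)) := by
    rw [Real.holderConjugate_iff]
    refine ⟨by rw [lt_div_iff₀ hq]; linarith, by simp⟩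
  have hS : 0 < ∑ k ∈ K, b k ^ p := sum_pos (fun k hk => Real.rpow_pos_of_pos (hb k hk) _) hK
  have hab : 0 ≤ ∑ k ∈ K, a k * b k :=
    sum_nonneg fun k hk => mul_nonneg (ha k hk) (hb k hk).le
  have hA : 0 ≤ ∑ k ∈ K, a k ^ q := sum_nonneg fun k hk => Real.rpow_nonneg (ha k hk) _
  have key : ∑ k ∈ K, a k ^ q ≤ (∑ k ∈ K, a k * b k) ^ q * (∑ k ∈ K, b k ^ p) ^ (1 - q) := by
    -- Ordinary Hölder with exponents `1/q` and `1/(1-q)`, for the factorization `a^q = (ab)^q *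
    -- b^(-q)`.
    have h := Real.inner_le_Lp_mul_Lq_of_nonneg K hconj
      (f := fun k => (a k * b k) ^ q) (g := fun k => b k ^ (-q))
      (fun k hk => Real.rpow_nonneg (mul_nonneg (ha k hk) (hb k hk).le) _)
      (fun k hk => Real.rpow_nonneg (hb k hk).le _)
    have e1 : ∀ k ∈ K, (a k * b k) ^ q * b k ^ (-q) = a k ^ q := fun k hk => by
      rw [Real.mul_rpow (ha k hk) (hb k hk).le, mul_assoc, ← Real.rpow_add (hb k hk)]; simp
    have e2 : ∀ k ∈ K, ((a k * b k) ^ q) ^ (1 / q) = a k * b k := fun k hk => by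
      rw [← Real.rpow_mul (mul_nonneg (ha k hk) (hb k hk).le), mul_one_div_cancel hq.ne',
        Real.rpow_one]
    have e3 : ∀ k ∈ K, (b k ^ (-q)) ^ (1 / (1 - q)) = b k ^ p := fun k hk => by
      rw [← Real.rpow_mul (hb k hk).le, hp]; congr 1; ring
    rw [sum_congr rfl e1, sum_congr rfl e2, sum_congr rfl e3, one_div_one_div, one_div_one_div] at h
    exact h
  have hle : (∑ k ∈ K, a k ^ q) ^ (1 / q) ≤
      (∑ k ∈ K, a k * b k) * (∑ k ∈ K, b k ^ p) ^ ((1 - q) / q) := by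
    refine (Real.rpow_le_rpow hA key (by positivity)).trans_eq ?_
    rw [Real.mul_rpow (Real.rpow_nonneg hab _) (Real.rpow_nonneg hS.le _), ← Real.rpow_mul hab,
      ← Real.rpow_mul hS.le, mul_one_div_cancel hq.ne', Real.rpow_one, mul_one_div]
  refine (mul_le_mul_of_nonneg_left hle (Real.rpow_nonneg hS.le _)).trans_eq ?_
  rw [mul_left_comm, ← Real.rpow_add hS]
  have : 1 / p + (1 - q) / q = 0 := by rw [sub_div, div_self hq.ne']; linarith
  rw [this, Real.rpow_zero, mul_one]

/-- The weights `x ^ (p - 1)`, normalized in the dual norm, recover the `p`-mean of `x`. -/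
theorem exists_dual_weight {K : Finset ι} {p q d : ℝ} (hd : 0 < d) (hp : p ≠ 0) (hq : q ≠ 0)
    (hpq : 1 / p + 1 / q = 1) {x : ι → ℝ} (hx : ∀ k ∈ K, 0 ≤ x k)
    (hxp : ∀ k ∈ K, x k ^ (p - 1) * x k = x k ^ p) (hS : 0 < ∑ k ∈ K, x k ^ p) :
    ∃ c : ℝ, 0 < c ∧
      d ^ ((q - 1) / q) * (∑ k ∈ K, (c * x k ^ (p - 1)) ^ q) ^ (1 / q) = 1 ∧
      ∑ k ∈ K, c * x k ^ (p - 1) * x k = 1 / d ^ (1 / p) * (∑ k ∈ K, x k ^ p) ^ (1 / p) := by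
  set S := ∑ k ∈ K, x k ^ p with hSdef
  have hqp : (q - 1) / q = 1 / p := by rw [sub_div, div_self hq]; linarith
  have hpq' : (p - 1) * q = p := by field_simp at hpq; linarith
  have hdp := Real.rpow_pos_of_pos hd (1 / p)
  have hSq := Real.rpow_pos_of_pos hS (1 / q)
  have hc : 0 < 1 / (d ^ (1 / p) * S ^ (1 / q)) := by positivity
  -- Since `(p-1)q = p`, the `q`-sum of `x^(p-1)` is `S^(1/q)`; `c` is the reciprocal of the
  -- resulting dual norm.
  refine ⟨1 / (d ^ (1 / p) * S ^ (1 / q)), hc, ?_, ?_⟩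
  · have e : ∀ k ∈ K, (1 / (d ^ (1 / p) * S ^ (1 / q)) * x k ^ (p - 1)) ^ q =
        (1 / (d ^ (1 / p) * S ^ (1 / q))) ^ q * x k ^ p := fun k hk => by
      rw [Real.mul_rpow hc.le (Real.rpow_nonneg (hx k hk) _), ← Real.rpow_mul (hx k hk), hpq']
    rw [sum_congr rfl e, ← mul_sum, ← hSdef, Real.mul_rpow (Real.rpow_nonneg hc.le _) hS.le,
      ← Real.rpow_mul hc.le, mul_one_div_cancel hq, Real.rpow_one, hqp]
    field_simp
  · have e : ∀ k ∈ K, 1 / (d ^ (1 / p) * S ^ (1 / q)) * x k ^ (p - 1) * x k =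
        1 / (d ^ (1 / p) * S ^ (1 / q)) * x k ^ p := fun k hk => by
      rw [mul_assoc, hxp k hk]
    rw [sum_congr rfl e, ← mul_sum, ← hSdef]
    have : S = S ^ (1 / p) * S ^ (1 / q) := by rw [← Real.rpow_add hS, hpq, Real.rpow_one]
    have h2 : 1 / (d ^ (1 / p) * S ^ (1 / q)) * (S ^ (1 / p) * S ^ (1 / q)) =
        1 / d ^ (1 / p) * S ^ (1 / p) := by field_simp
    rw [← h2, ← this]

theorem phiSum_of_pos {K : Finset ι} {p : ℝ} {x : ι → ℝ} (hx : ∀ k ∈ K, 0 < x k) :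
    phiSum p K x = (∑ k ∈ K, x k ^ p) ^ (1 / p) :=
  if_neg fun ⟨_, k, hk, h⟩ => (hx k hk).ne' h

theorem phiSum_of_nonneg {K : Finset ι} {p : ℝ} (hp : 0 ≤ p) (x : ι → ℝ) :
    phiSum p K x = (∑ k ∈ K, x k ^ p) ^ (1 / p) :=
  if_neg fun h => h.1.not_ge hp

theorem phiSum_nonneg {K : Finset ι} {p : ℝ} {x : ι → ℝ} (hx : ∀ k ∈ K, 0 ≤ x k) :
    0 ≤ phiSum p K x := by
  unfold phiSum
  split_ifs
  · exact le_rfl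
  · exact Real.rpow_nonneg (sum_nonneg fun k hk => Real.rpow_nonneg (hx k hk) _) _

theorem phiSum_le_of_neg {K : Finset ι} {p : ℝ} (hp : p < 0) {x : ι → ℝ}
    (hx : ∀ k ∈ K, 0 ≤ x k) {j : ι} (hj : j ∈ K) : phiSum p K x ≤ x j := by
  unfold phiSum
  split_ifs with h
  · exact hx j hj
  · have hpos : ∀ k ∈ K, 0 < x k := fun k hk =>
      (hx k hk).lt_of_ne fun h0 => h ⟨hp, k, hk, h0.symm⟩
    have h1 : x j ^ p ≤ ∑ k ∈ K, x k ^ p :=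
      single_le_sum (f := fun k => x k ^ p) (fun k hk => Real.rpow_nonneg (hx k hk) _) hj
    refine (Real.rpow_le_rpow_of_nonpos (Real.rpow_pos_of_pos (hpos j hj) _) h1
      (one_div_neg.mpr hp).le).trans_eq ?_
    rw [← Real.rpow_mul (hx j hj), mul_one_div_cancel hp.ne, Real.rpow_one]

/-- For `p < 0` the delicate points have a zero coordinate `x j`: there `0 ≤ phiSum ≤ y j` squeezes
the value to `0`, the conventional one. -/
theorem continuousOn_phiSum {K : Finset ι} {p : ℝ} (hp : p ≠ 0) (hK : K.Nonempty) :
    ContinuousOn (phiSum p K) {x : ι → ℝ | 0 ≤ x} := by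
  rcases hp.lt_or_gt with hneg | hpos
  · intro x hx
    by_cases h : ∃ k ∈ K, x k = 0
    · obtain ⟨j, hj, hxj⟩ := h
      have h0 : phiSum p K x = 0 := if_pos ⟨hneg, j, hj, hxj⟩
      rw [ContinuousWithinAt, h0]
      have hlim : Tendsto (fun y : ι → ℝ => y j) (𝓝[{x | 0 ≤ x}] x) (𝓝 0) := by
        rw [← hxj]; exact (continuous_apply j).continuousWithinAt
      refine tendsto_of_tendsto_of_tendsto_of_le_of_le' tendsto_const_nhds hlim ?_ ?_
      · filter_upwards [self_mem_nhdsWithin] with y hy using phiSum_nonneg fun k _ => hy k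
      · filter_upwards [self_mem_nhdsWithin] with y hy using
          phiSum_le_of_neg hneg (fun k _ => hy k) hj
    · push Not at h
      have hxpos : ∀ k ∈ K, 0 < x k := fun k hk => (hx k).lt_of_ne (h k hk).symm
      have hev : ∀ᶠ y : ι → ℝ in 𝓝 x, ∀ k ∈ K, 0 < y k :=
        (K.eventually_all).mpr fun k hk =>
          (continuous_apply k).continuousAt.eventually (lt_mem_nhds (hxpos k hk))
      have hc : ContinuousAt (fun y : ι → ℝ => (∑ k ∈ K, y k ^ p) ^ (1 / p)) x := by
        refine ContinuousAt.rpow_const (tendsto_finsetSum _ fun k hk =>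
          ((continuous_apply k).continuousAt.rpow_const (Or.inl (h k hk)))) (Or.inl ?_)
        exact (sum_pos (fun k hk => Real.rpow_pos_of_pos (hxpos k hk) _) hK).ne'
      refine (hc.congr ?_).continuousWithinAt
      filter_upwards [hev] with y hy using (phiSum_of_pos hy).symm
  · refine Continuous.continuousOn ?_
    have : phiSum p K = fun x : ι → ℝ => (∑ k ∈ K, x k ^ p) ^ (1 / p) :=
      funext fun x => phiSum_of_nonneg hpos.le x
    rw [this]
    refine Continuous.rpow_const (continuous_finsetSum _ fun k _ =>
      (continuous_apply k).rpow_const fun _ => Or.inr hpos.le) fun _ => Or.inr ?_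
    positivity

/-- Exactly one of `p`, `q` is negative. If the family carrying that exponent has a zero, the left
side vanishes by convention; otherwise reverse Hölder applies, with roles swapped according to the
sign of `p`. -/
theorem phiSum_mul_phiSum_le {K : Finset ι} {p q : ℝ} (hp : p < 1) (hp0 : p ≠ 0)
    (hpq : 1 / p + 1 / q = 1) (hK : K.Nonempty) {v x : ι → ℝ} (hv : ∀ k ∈ K, 0 ≤ v k)
    (hx : ∀ k ∈ K, 0 ≤ x k) : phiSum p K x * phiSum q K v ≤ ∑ k ∈ K, v k * x k := by
  have hnn : 0 ≤ ∑ k ∈ K, v k * x k := sum_nonneg fun k hk => mul_nonneg (hv k hk) (hx k hk)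
  rcases hp0.lt_or_gt with hneg | hpos
  · have hp1 : 1 / p < 0 := one_div_neg.mpr hneg
    have hq : 0 < q := one_div_pos.mp (by linarith)
    have hq1 : q < 1 := by
      by_contra! h
      have := (div_le_one hq).mpr h
      linarith
    by_cases h : ∃ k ∈ K, x k = 0
    · rw [show phiSum p K x = 0 from if_pos ⟨hneg, h⟩, zero_mul]; exact hnn
    · push Not at h
      have hx' : ∀ k ∈ K, 0 < x k := fun k hk => (hx k hk).lt_of_ne (h k hk).symm
      rw [phiSum_of_pos hx', phiSum_of_nonneg hq.le]
      exact reverse_holder hq hq1 hpq hv hx' hK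
  · have hp1 : 1 < 1 / p := by rw [lt_div_iff₀ hpos]; linarith
    have hq : q < 0 := one_div_neg.mp (by linarith)
    by_cases h : ∃ k ∈ K, v k = 0
    · rw [show phiSum q K v = 0 from if_pos ⟨hq, h⟩, mul_zero]; exact hnn
    · push Not at h
      have hv' : ∀ k ∈ K, 0 < v k := fun k hk => (hv k hk).lt_of_ne (h k hk).symm
      rw [phiSum_of_pos hv', phiSum_of_nonneg hpos.le, mul_comm]
      simp_rw [mul_comm (v _)]
      exact reverse_holder hpos hp (by linarith) hx hv' hK

/-- First-order optimality condition for a separable power-type objective on a compact convex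
set. -/
theorem exists_power_support [Fintype ι] (K : Finset ι) {F : Set (ι → ℝ)} (hF : IsCompact F)
    (hconv : Convex ℝ F) (hne : F.Nonempty) (hnn : ∀ x ∈ F, 0 ≤ x) (p : ℝ) {ε : ℝ} (hε : 0 < ε) :
    ∃ x ∈ F, ∀ y ∈ F,
      ∑ k ∈ K, (x k + ε) ^ (p - 1) * y k ≤ ∑ k ∈ K, (x k + ε) ^ (p - 1) * x k := by
  obtain ⟨h, hh⟩ : ∃ h : ℝ → ℝ, ∀ x, 0 < x → HasDerivAt h (x ^ (p - 1)) x := by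
    by_cases hp : p = 0
    · refine ⟨Real.log, fun x hx => ?_⟩
      rw [hp, zero_sub, Real.rpow_neg_one]
      exact Real.hasDerivAt_log hx.ne'
    · refine ⟨fun x => x ^ p / p, fun x hx => ?_⟩
      have := (Real.hasDerivAt_rpow_const (p := p) (Or.inl hx.ne')).div_const p
      rwa [mul_div_cancel_left₀ _ hp] at this
  have hcont : ContinuousOn (fun y : ι → ℝ => ∑ k ∈ K, h (y k + ε)) F := by
    refine continuousOn_finsetSum _ fun k _ y hy => ?_
    have hc : ContinuousAt (fun y : ι → ℝ => y k + ε) y :=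
      ((continuous_apply k).add continuous_const).continuousAt
    exact (ContinuousAt.comp (f := fun y : ι → ℝ => y k + ε)
      (hh _ (add_pos_of_nonneg_of_pos (hnn y hy k) hε)).continuousAt hc).continuousWithinAt
  obtain ⟨x, hxF, hmax⟩ := hF.exists_isMaxOn hne hcont
  refine ⟨x, hxF, fun y hy => ?_⟩
  set φ : ℝ → ℝ := fun t => ∑ k ∈ K, h (x k + t * (y k - x k) + ε) with hφ
  have hder : HasDerivAt φ (∑ k ∈ K, (x k + ε) ^ (p - 1) * (y k - x k)) 0 := by
    refine HasDerivAt.fun_sum fun k _ => ?_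
    have h1 : HasDerivAt (fun t : ℝ => x k + t * (y k - x k) + ε) (y k - x k) 0 := by
      simpa using (((hasDerivAt_id (0 : ℝ)).mul_const (y k - x k)).const_add (x k)).add_const ε
    have h2 := hh (x k + 0 * (y k - x k) + ε)
      (by rw [zero_mul, add_zero]; exact add_pos_of_nonneg_of_pos (hnn x hxF k) hε)
    have h3 := HasDerivAt.comp (0 : ℝ) h2 h1
    rw [zero_mul, add_zero] at h3
    exact h3
  -- Convexity keeps the segment from `x` to `y` in `F`, so the one-sided derivative of `φ` at `0`
  -- is nonpositive.
  have hloc : IsLocalMaxOn φ (Set.Icc 0 1) 0 := by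
    filter_upwards [self_mem_nhdsWithin] with t ht
    have hmem := hconv.add_smul_sub_mem hxF hy ht
    simpa [hφ] using hmax hmem
  have hcone : (1 : ℝ) ∈ posTangentConeAt (Set.Icc (0 : ℝ) 1) 0 := by
    refine mem_posTangentConeAt_of_segment_subset ?_
    rw [zero_add, segment_eq_Icc zero_le_one]
  have hle := hloc.hasFDerivWithinAt_nonpos hder.hasFDerivAt.hasFDerivWithinAt hcone
  simp only [ContinuousLinearMap.toSpanSingleton_apply, smul_eq_mul, one_mul, mul_sub,
    sum_sub_distrib] at hle
  linarith

/-- If no point of a convex set exceeds `s` in all coordinates of `K`, some weights on `K` keep its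
weighted means below any `t > s`. -/
theorem exists_weight_of_no_dominating [Fintype ι] [DecidableEq ι] {K : Finset ι}
    {F : Set (ι → ℝ)} (hconv : Convex ℝ F) (h0 : (0 : ι → ℝ) ∈ F)
    (hsupp : ∀ x ∈ F, ∀ k ∉ K, x k = 0) {s t : ℝ} (hst : s < t)
    (hs : ∀ x ∈ F, ∃ k ∈ K, x k ≤ s) :
    ∃ v : ι → ℝ, 0 ≤ v ∧ ∑ k ∈ K, v k = 1 ∧ ∀ x ∈ F, ∑ k ∈ K, v k * x k ≤ t := by
  set U : Set (ι → ℝ) := {x | ∀ k ∈ K, s < x k} with hU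
  have hUo : IsOpen U := by
    have : U = ⋂ k ∈ K, {x : ι → ℝ | s < x k} := by ext; simp [hU]
    rw [this]
    exact isOpen_biInter_finset fun k _ => isOpen_lt continuous_const (continuous_apply k)
  have hUc : Convex ℝ U := by
    intro x hx y hy a b ha hb hab k hk
    have h1 := hx k hk
    have h2 := hy k hk
    simp only [Pi.add_apply, Pi.smul_apply, smul_eq_mul]
    have : s = a * s + b * s := by rw [← add_mul, hab, one_mul]
    rcases ha.eq_or_lt with rfl | ha
    · rw [zero_add] at hab; subst hab; linarith
    · have := mul_lt_mul_of_pos_left h1 ha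
      have := mul_le_mul_of_nonneg_left h2.le hb
      linarith
  have hdisj : Disjoint U F := Set.disjoint_left.mpr fun x hxU hxF => by
    obtain ⟨k, hk, hle⟩ := hs x hxF
    exact absurd (hxU k hk) hle.not_gt
  obtain ⟨f, u, hfU, hfF⟩ := geometric_hahn_banach_open hUc hUo hconv hdisj
  -- The sign is reversed because `f` is bounded above on the upward-closed set `U`.
  set c : ι → ℝ := fun k => -f (Pi.single k 1) with hc
  have hf : ∀ x : ι → ℝ, f x = -∑ k, c k * x k := fun x => by
    conv_lhs => rw [← univ_sum_single x, map_sum]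
    rw [← sum_neg_distrib]
    refine sum_congr rfl fun k _ => ?_
    have : (Pi.single k (x k) : ι → ℝ) = x k • Pi.single k (1 : ℝ) := by
      rw [← Pi.single_smul]; simp
    rw [this, map_smul, smul_eq_mul, hc]; ring
  have hfK : ∀ x : ι → ℝ, (∀ k ∉ K, x k = 0) → f x = -∑ k ∈ K, c k * x k := fun x hx => by
    rw [hf, sum_subset (subset_univ K)]
    intro k _ hk
    rw [hx k hk, mul_zero]
  -- As `s < t`, this point lies in `U`; it brings the bound `t` into the separation inequality.
  set o : ι → ℝ := fun k => if k ∈ K then t else 0 with ho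
  have hoU : o ∈ U := fun k hk => by simp [ho, hk, hst]
  have hfo : f o = -(t * ∑ k ∈ K, c k) := by
    rw [hfK o fun k hk => by simp [ho, hk], mul_sum]
    congr 1
    exact sum_congr rfl fun k hk => by simp [ho, hk, mul_comm]
  have hcnn : ∀ k, 0 ≤ c k := by
    intro k
    by_contra! hneg
    have hmem : ∀ r : ℝ, 0 ≤ r → o + r • Pi.single k (1 : ℝ) ∈ U := fun r hr j hj => by
      have h1 := hoU j hj
      have h2 : 0 ≤ r * (Pi.single k (1 : ℝ) : ι → ℝ) j :=
        mul_nonneg hr (by rw [Pi.single_apply]; split_ifs <;> norm_num)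
      simp only [Pi.add_apply, Pi.smul_apply, smul_eq_mul]
      linarith
    have hou := hfU o hoU
    -- With `c k < 0`, moving this far along coordinate `k` stays in `U` but raises `f` to `u`, a
    -- contradiction.
    have hr : 0 ≤ (u - f o) / -c k := div_nonneg (by linarith) (by linarith)
    have := hfU _ (hmem _ hr)
    rw [map_add, map_smul, smul_eq_mul, show f (Pi.single k 1) = -c k by simp [hc],
      div_mul_cancel₀ _ (by linarith)] at this
    linarith
  have hbd : ∀ x ∈ F, ∑ k ∈ K, c k * x k < t * ∑ k ∈ K, c k := fun x hx => by
    have h1 := hfF x hx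
    have h2 := hfU o hoU
    rw [hfK x (hsupp x hx)] at h1
    rw [hfo] at h2
    linarith
  have hsum : 0 < ∑ k ∈ K, c k := by
    refine (sum_nonneg fun k _ => hcnn k).lt_of_ne fun h => ?_
    have := hbd 0 h0
    simp [← h] at this
  refine ⟨fun k => c k / ∑ k ∈ K, c k, fun k => div_nonneg (hcnn k) hsum.le, ?_, fun x hx => ?_⟩
  · rw [← sum_div, div_self hsum.ne']
  · simp_rw [div_mul_eq_mul_div]
    rw [← sum_div, div_le_iff₀ hsum]
    exact (hbd x hx).le

end Aggregators

/-! ### Slack sets and the general duality theorems -/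

section Technology

variable {m n : ℕ} {T : Set (Netput m n)} {z g : Netput m n}

theorem mem_supp {k : Fin m ⊕ Fin n} : k ∈ supp g ↔ g k ≠ 0 := by simp [supp]

theorem supp_pos (hg : 0 ≤ g) {k : Fin m ⊕ Fin n} (hk : k ∈ supp g) : 0 < g k :=
  (hg k).lt_of_ne (mem_supp.mp hk).symm

theorem suppCard_pos (hg : g ≠ 0) : 0 < suppCard g :=
  Nat.cast_pos.mpr (supp_nonempty hg).card_pos

/-- The slack vectors supported by `supp g` that are feasible from `z` in the direction `g`. -/
def slackSet (T : Set (Netput m n)) (z g : Netput m n) : Set (Netput m n) :=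
  {δ | 0 ≤ δ ∧ (∀ k ∉ supp g, δ k = 0) ∧ z + δ * g ∈ T}

theorem zero_mem_slackSet (hz : z ∈ T) : 0 ∈ slackSet T z g :=
  ⟨le_rfl, fun _ _ => rfl, by simpa using hz⟩

theorem convex_slackSet (hT : Convex ℝ T) : Convex ℝ (slackSet T z g) := by
  rintro x ⟨hx, hx0, hxT⟩ y ⟨hy, hy0, hyT⟩ a b ha hb hab
  refine ⟨add_nonneg (smul_nonneg ha hx) (smul_nonneg hb hy), fun k hk => ?_, ?_⟩
  · simp [hx0 k hk, hy0 k hk]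
  · convert hT hxT hyT ha hb hab using 1
    ext k
    simp only [Pi.add_apply, Pi.mul_apply, Pi.smul_apply, smul_eq_mul]
    linear_combination -z k * hab

theorem slackSet_subset_Icc (hT : IsTechnology T) (hz : z ∈ T) (hg : 0 ≤ g) :
    ∃ b : Netput m n, slackSet T z g ⊆ Set.Icc 0 b := by
  obtain ⟨R, hR⟩ := (hT.bounded z hz).exists_norm_le
  -- Off the support, division by zero makes the bound `0`, matching the vanishing slack.
  refine ⟨fun k => (R - z k) / g k, fun δ hδ => ⟨hδ.1, fun k => ?_⟩⟩
  by_cases hk : k ∈ supp g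
  · rw [le_div_iff₀ (supp_pos hg hk)]
    have h1 := hR (z + δ * g) ⟨hδ.2.2, le_add_of_nonneg_right (mul_nonneg hδ.1 hg)⟩
    have h2 := (le_abs_self _).trans ((norm_le_pi_norm (z + δ * g) k).trans h1)
    simp only [Pi.add_apply, Pi.mul_apply] at h2
    linarith
  · simp [hδ.2.1 k hk, not_not.mp (mem_supp.not.mp hk)]

theorem isCompact_slackSet (hT : IsTechnology T) (hz : z ∈ T) (hg : 0 ≤ g) :
    IsCompact (slackSet T z g) := by
  obtain ⟨b, hb⟩ := slackSet_subset_Icc hT hz hg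
  refine isCompact_Icc.of_isClosed_subset ?_ hb
  have : slackSet T z g =
      {δ | 0 ≤ δ} ∩ ((⋂ k, ⋂ (_ : k ∉ supp g), {δ | δ k = 0}) ∩ (fun δ => z + δ * g) ⁻¹' T) := by
    ext δ; simp [slackSet]
  rw [this]
  refine isClosed_Ici.inter (IsClosed.inter ?_ (hT.closed.preimage (by fun_prop)))
  exact isClosed_iInter fun k => isClosed_iInter fun _ =>
    isClosed_eq (continuous_apply k) continuous_const

theorem dotProduct_slack (w δ : Netput m n) :
    w ⬝ᵥ (z + δ * g) = ∑ k ∈ supp g, g k * w k * δ k + w ⬝ᵥ z := by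
  rw [dotProduct_add, add_comm]
  congr 1
  rw [dotProduct, sum_subset (subset_univ (supp g))]
  · exact sum_congr rfl fun k _ => by simp only [Pi.mul_apply]; ring
  · intro k _ hk
    rw [not_not.mp (mem_supp.not.mp hk), zero_mul, zero_mul]

/-- The slack vector that leads from `z` to `u` on the support of `g`. -/
noncomputable def slackOf (z g u : Netput m n) : Netput m n := fun k => (u k - z k) / g k

theorem slackOf_nonneg (hg : 0 ≤ g) {u : Netput m n} (hu : z ≤ u) : 0 ≤ slackOf z g u :=
  fun k => div_nonneg (sub_nonneg.mpr (hu k)) (hg k)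

theorem add_slackOf_mul {u : Netput m n} {k : Fin m ⊕ Fin n} (hk : k ∈ supp g) :
    (z + slackOf z g u * g) k = u k := by
  simp [slackOf, div_mul_cancel₀ _ (mem_supp.mp hk)]

theorem add_slackOf_mul_of_notMem {u : Netput m n} {k : Fin m ⊕ Fin n} (hk : k ∉ supp g) :
    (z + slackOf z g u * g) k = z k := by
  simp [not_not.mp (mem_supp.not.mp hk)]

/-- The point reached is `u` lowered to `z` off the support, feasible by free disposal. -/
theorem slackOf_mem (hT : IsTechnology T) (hg : 0 ≤ g) {u : Netput m n}
    (hu : u ∈ dominating T z) : slackOf z g u ∈ slackSet T z g := by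
  refine ⟨slackOf_nonneg hg hu.2, fun k hk => ?_, hT.free_disposal u hu.1 _ fun k => ?_⟩
  · rw [slackOf, not_not.mp (mem_supp.not.mp hk), div_zero]
  · by_cases hk : k ∈ supp g
    · rw [add_slackOf_mul hk]
    · rw [add_slackOf_mul_of_notMem hk]; exact hu.2 k

theorem coe_sub_le_iff {a b : ℝ} {B : EReal} :
    (((a + b : ℝ) : EReal) ≤ B + (b : EReal)) ↔ (a : EReal) ≤ B := by
  rw [← EReal.sub_le_iff_le_add (Or.inl (EReal.coe_ne_bot b)) (Or.inl (EReal.coe_ne_top b)),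
    ← EReal.coe_sub, add_sub_cancel_right]

theorem profitDir_sub_le (hT : IsTechnology T) (hg : 0 ≤ g) {w : Netput m n} {B : EReal}
    (h : ∀ δ ∈ slackSet T z g, ((∑ k ∈ supp g, g k * w k * δ k : ℝ) : EReal) ≤ B) :
    profitDir T z g w - ((w ⬝ᵥ z : ℝ) : EReal) ≤ B := by
  rw [EReal.sub_le_iff_le_add (Or.inl (EReal.coe_ne_bot _)) (Or.inl (EReal.coe_ne_top _))]
  refine iSup_le fun u => iSup_le fun hu => iSup_le fun huz => ?_
  have hu' : u = z + slackOf z g u * g := by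
    ext k
    by_cases hk : k ∈ supp g
    · rw [add_slackOf_mul hk]
    · rw [add_slackOf_mul_of_notMem hk, huz k hk]
  have hd : w ⬝ᵥ u = ∑ k ∈ supp g, g k * w k * slackOf z g u k + w ⬝ᵥ z := by
    rw [← dotProduct_slack, ← hu']
  rw [hd, coe_sub_le_iff]
  exact h _ (slackOf_mem hT hg hu)

/-- With zero prices off the support, gains there earn nothing. This is why the infimum formulas may
use the unrestricted profit. -/
theorem profit_sub_le (hT : IsTechnology T) (hg : 0 ≤ g) {w : Netput m n}
    (hw : ∀ k ∉ supp g, w k = 0) {B : EReal}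
    (h : ∀ δ ∈ slackSet T z g, ((∑ k ∈ supp g, g k * w k * δ k : ℝ) : EReal) ≤ B) :
    profit T z w - ((w ⬝ᵥ z : ℝ) : EReal) ≤ B := by
  rw [EReal.sub_le_iff_le_add (Or.inl (EReal.coe_ne_bot _)) (Or.inl (EReal.coe_ne_top _))]
  refine iSup₂_le fun u hu => ?_
  have hd : w ⬝ᵥ u = ∑ k ∈ supp g, g k * w k * slackOf z g u k + w ⬝ᵥ z := by
    rw [← dotProduct_slack]
    refine sum_congr rfl fun k _ => ?_
    by_cases hk : k ∈ supp g
    · rw [add_slackOf_mul hk]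
    · rw [hw k hk, zero_mul, zero_mul]
  rw [hd, coe_sub_le_iff]
  exact h _ (slackOf_mem hT hg hu)

theorem le_profitDir_sub (hg : 0 ≤ g) {w δ : Netput m n} (hδ : 0 ≤ δ) (hδT : z + δ * g ∈ T) :
    ((∑ k ∈ supp g, g k * w k * δ k : ℝ) : EReal) ≤
      profitDir T z g w - ((w ⬝ᵥ z : ℝ) : EReal) := by
  have h : ((w ⬝ᵥ (z + δ * g) : ℝ) : EReal) ≤ profitDir T z g w :=
    le_iSup_of_le (z + δ * g) <|
      le_iSup_of_le ⟨hδT, le_add_of_nonneg_right (mul_nonneg hδ hg)⟩ <|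
        le_iSup_of_le (fun k hk => by simp [not_not.mp (mem_supp.not.mp hk)]) le_rfl
  refine le_trans (le_of_eq ?_) (EReal.sub_le_sub h le_rfl)
  rw [dotProduct_slack, ← EReal.coe_sub, add_sub_cancel_right]

theorem profitDir_le_profit (w : Netput m n) : profitDir T z g w ≤ profit T z w :=
  iSup_mono fun _ => iSup_mono fun _ => iSup_le fun _ => le_rfl

theorem le_profit_sub (hg : 0 ≤ g) {w δ : Netput m n} (hδ : 0 ≤ δ) (hδT : z + δ * g ∈ T) :
    ((∑ k ∈ supp g, g k * w k * δ k : ℝ) : EReal) ≤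
      profit T z w - ((w ⬝ᵥ z : ℝ) : EReal) :=
  (le_profitDir_sub hg hδ hδT).trans (EReal.sub_le_sub (profitDir_le_profit w) le_rfl)

theorem slackDist_eq (A : Netput m n → ℝ) (hz : z ∈ T) (hg : g ≠ 0) :
    slackDist A T z g =
      ⨆ (δ : Netput m n) (_ : 0 ≤ δ) (_ : z + δ * g ∈ T), (A δ : EReal) := by
  simp [slackDist, hz, hg]

/-- Prices with prescribed values `g k * w k` on the support of `g`, and zero elsewhere. -/
theorem exists_price (hg : 0 ≤ g) {v : Netput m n} (hv : ∀ k ∈ supp g, 0 ≤ v k) :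
    ∃ w : Netput m n, 0 ≤ w ∧ (∀ k ∉ supp g, w k = 0) ∧ ∀ k ∈ supp g, g k * w k = v k := by
  refine ⟨fun k => v k / g k, fun k => ?_, fun k hk => ?_, fun k hk => ?_⟩
  · by_cases hk : k ∈ supp g
    · exact div_nonneg (hv k hk) (hg k)
    · simp [not_not.mp (mem_supp.not.mp hk)]
  · simp [not_not.mp (mem_supp.not.mp hk)]
  · exact mul_div_cancel₀ _ (mem_supp.mp hk)

/-- Dual representation of an aggregator that is a maximum of normalized linear functions. -/
theorem slackDist_eq_iSup {A : Netput m n → ℝ} {P : Netput m n → Prop} (hT : IsTechnology T)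
    (hz : z ∈ T) (hg : 0 ≤ g) (hg0 : g ≠ 0)
    (hle : ∀ w, 0 ≤ w → P w → ∀ δ, 0 ≤ δ → ∑ k ∈ supp g, g k * w k * δ k ≤ A δ)
    (hex : ∀ δ, 0 ≤ δ → ∃ w, 0 ≤ w ∧ P w ∧ A δ ≤ ∑ k ∈ supp g, g k * w k * δ k) :
    slackDist A T z g = ⨆ (w : Netput m n) (_ : 0 ≤ w) (_ : P w),
      (profitDir T z g w - ((w ⬝ᵥ z : ℝ) : EReal)) := by
  rw [slackDist_eq A hz hg0]
  refine le_antisymm (iSup_le fun δ => iSup_le fun hδ => iSup_le fun hδT => ?_)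
    (iSup_le fun w => iSup_le fun hw => iSup_le fun hP => profitDir_sub_le hT hg fun δ hδ => ?_)
  · obtain ⟨w, hw, hP, hA⟩ := hex δ hδ
    exact le_iSup_of_le w <| le_iSup_of_le hw <| le_iSup_of_le hP <|
      (EReal.coe_le_coe_iff.mpr hA).trans (le_profitDir_sub hg hδ hδT)
  · exact le_iSup_of_le δ <| le_iSup_of_le hδ.1 <| le_iSup_of_le hδ.2.2 <|
      EReal.coe_le_coe_iff.mpr (hle w hw hP δ hδ.1)

/-- Uniform continuity on the box enlarged by `1`, which contains the shifted points since `ε ≤ 1`.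
-/
theorem exists_shift_le {ι : Type*} [Fintype ι] {A : (ι → ℝ) → ℝ}
    (hA : ContinuousOn A {x | 0 ≤ x}) (b : ι → ℝ) {η : ℝ} (hη : 0 < η) :
    ∃ ε : ℝ, 0 < ε ∧ ∀ x ∈ Set.Icc 0 b, A (fun k => x k + ε) ≤ A x + η := by
  have hc : IsCompact (Set.Icc (0 : ι → ℝ) (fun k => b k + 1)) := isCompact_Icc
  have hu := hc.uniformContinuousOn_of_continuous (hA.mono fun x hx => hx.1)
  obtain ⟨r, hr, h⟩ := Metric.uniformContinuousOn_iff.mp hu η hη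
  have hε : 0 < min (r / 2) 1 := lt_min (by linarith) one_pos
  refine ⟨min (r / 2) 1, hε, fun x hx => ?_⟩
  have hd := h (fun k => x k + min (r / 2) 1)
    ⟨fun k => add_nonneg (hx.1 k) hε.le, fun k => add_le_add (hx.2 k) (min_le_right _ _)⟩
    x ⟨hx.1, fun k => (hx.2 k).trans (by simp)⟩ ?_
  · have := (abs_lt.mp hd).2
    linarith
  · refine lt_of_le_of_lt ((dist_pi_le_iff hε.le).mpr fun k => ?_)
      (lt_of_le_of_lt (min_le_left _ _) (half_lt_self hr))
    rw [Real.dist_eq, add_sub_cancel_left, abs_of_pos hε]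

/-- Dual representation of an aggregator that is a minimum of normalized linear functions, whose
minimizing weights at `x` are proportional to `x ^ (p - 1)`. -/
theorem slackDist_eq_iInf {A : Netput m n → ℝ} {P : Netput m n → Prop} (p : ℝ)
    (hT : IsTechnology T) (hconv : Convex ℝ T) (hz : z ∈ T) (hg : 0 ≤ g) (hg0 : g ≠ 0)
    (hA : ContinuousOn A {x | 0 ≤ x})
    (hle : ∀ w, 0 ≤ w → P w → ∀ δ, 0 ≤ δ → A δ ≤ ∑ k ∈ supp g, g k * w k * δ k)
    (hex : ∀ x : Netput m n, (∀ k, 0 < x k) → ∃ c : ℝ, 0 < c ∧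
      ∑ k ∈ supp g, c * x k ^ (p - 1) * x k = A x ∧
      ∀ w : Netput m n, (∀ k ∈ supp g, g k * w k = c * x k ^ (p - 1)) → P w) :
    slackDist A T z g = ⨅ (w : Netput m n) (_ : 0 ≤ w) (_ : P w),
      (profit T z w - ((w ⬝ᵥ z : ℝ) : EReal)) := by
  rw [slackDist_eq A hz hg0]
  refine le_antisymm (iSup_le fun δ => iSup_le fun hδ => iSup_le fun hδT =>
    le_iInf fun w => le_iInf fun hw => le_iInf fun hP => ?_) ?_
  · exact (EReal.coe_le_coe_iff.mpr (hle w hw hP δ hδ)).trans (le_profit_sub hg hδ hδT)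
  -- The infimum need not be attained: for each real `t` above the distance, a price with normalized
  -- profit at most `t` suffices. The gap `t - s` pays for the shift.
  · refine EReal.le_of_forall_lt_iff_le.mp fun t ht => ?_
    obtain ⟨s, hs, hst⟩ := EReal.lt_iff_exists_real_btwn.mp ht
    rw [EReal.coe_lt_coe_iff] at hst
    obtain ⟨b, hb⟩ := slackSet_subset_Icc hT hz hg
    obtain ⟨ε, hε, hshift⟩ := exists_shift_le hA b (sub_pos.mpr hst)
    obtain ⟨y, hy, hmax⟩ := exists_power_support (supp g) (isCompact_slackSet hT hz hg)
      (convex_slackSet hconv) ⟨0, zero_mem_slackSet hz⟩ (fun x hx => hx.1) p hε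
    have hpos : ∀ k, 0 < y k + ε := fun k => add_pos_of_nonneg_of_pos (hy.1 k) hε
    obtain ⟨c, hc, hcA, hP⟩ := hex (fun k => y k + ε) hpos
    obtain ⟨w, hw, hw0, hgw⟩ := exists_price hg (v := fun k => c * (y k + ε) ^ (p - 1))
      fun k _ => mul_nonneg hc.le (Real.rpow_nonneg (hpos k).le _)
    refine iInf_le_of_le w <| iInf_le_of_le hw <| iInf_le_of_le (hP w hgw) <|
      profit_sub_le hT hg hw0 fun δ hδ => EReal.coe_le_coe_iff.mpr ?_
    have hAy : A y ≤ s := by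
      refine EReal.coe_le_coe_iff.mp (le_trans ?_ hs.le)
      exact le_iSup_of_le y <| le_iSup_of_le hy.1 <| le_iSup_of_le hy.2.2 le_rfl
    have h1 := hshift y (hb hy)
    calc ∑ k ∈ supp g, g k * w k * δ k
        = c * ∑ k ∈ supp g, (y k + ε) ^ (p - 1) * δ k := by
          rw [mul_sum]; exact sum_congr rfl fun k hk => by rw [hgw k hk, mul_assoc]
      _ ≤ c * ∑ k ∈ supp g, (y k + ε) ^ (p - 1) * y k :=
          mul_le_mul_of_nonneg_left (hmax δ hδ) hc.le
      _ ≤ ∑ k ∈ supp g, c * (y k + ε) ^ (p - 1) * (y k + ε) := by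
          rw [mul_sum]
          refine sum_le_sum fun k _ => ?_
          rw [← mul_assoc]
          exact mul_le_mul_of_nonneg_left (by linarith)
            (mul_nonneg hc.le (Real.rpow_nonneg (hpos k).le _))
      _ = A fun k => y k + ε := hcA
      _ ≤ t := by linarith

end Technology

/-! ### The six dual formulas -/

section Duality

variable {m n : ℕ} {T : Set (Netput m n)} {z g : Netput m n}

theorem genDist_eq_iSup (hT : IsTechnology T) (hz : z ∈ T) (hg : 0 ≤ g) (hg0 : g ≠ 0) {p q : ℝ}
    (hp : 1 < p) (hpq : 1 / p + 1 / q = 1) :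
    genDist p T z g =
      ⨆ (w : Netput m n) (_ : 0 ≤ w)
        (_ : suppCard g ^ ((q - 1) / q) * (∑ k ∈ supp g, (g k * w k) ^ q) ^ (1 / q) = 1),
        (profitDir T z g w - ((w ⬝ᵥ z : ℝ) : EReal)) := by
  have hp0 : 0 < p := by linarith
  have hd := suppCard_pos hg0
  have hconj : p.HolderConjugate q := by
    rw [Real.holderConjugate_iff]; exact ⟨hp, by simpa using hpq⟩
  have hq0 : 0 < q := hconj.symm.pos
  have hqp : (q - 1) / q = 1 / p := by rw [sub_div, div_self hq0.ne']; linarith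
  have hdp := Real.rpow_pos_of_pos hd (1 / p)
  refine slackDist_eq_iSup hT hz hg hg0 (fun w hw hP δ hδ => ?_) (fun δ hδ => ?_)
  · have h := Real.inner_le_Lp_mul_Lq_of_nonneg (supp g) hconj.symm
      (f := fun k => g k * w k) (g := δ) (fun k _ => mul_nonneg (hg k) (hw k)) (fun k _ => hδ k)
    rw [hqp] at hP
    rw [phiSum_of_nonneg hp0.le]
    refine h.trans_eq ?_
    rw [eq_div_of_mul_eq hdp.ne' ((mul_comm _ _).trans hP)]
  · rw [phiSum_of_nonneg hp0.le]
    have hweights : ∀ x : Netput m n, 0 ≤ x → 0 < ∑ k ∈ supp g, x k ^ p →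
        ∃ w : Netput m n, 0 ≤ w ∧
          suppCard g ^ ((q - 1) / q) * (∑ k ∈ supp g, (g k * w k) ^ q) ^ (1 / q) = 1 ∧
          ∑ k ∈ supp g, g k * w k * x k =
            1 / suppCard g ^ (1 / p) * (∑ k ∈ supp g, x k ^ p) ^ (1 / p) := by
      intro x hx hS
      obtain ⟨c, hc, h1, h2⟩ := exists_dual_weight hd hp0.ne' hq0.ne' hpq
        (fun k _ => hx k) (fun k _ => by
          rcases (hx k).eq_or_lt with h0 | h0
          · rw [← h0]; simp [Real.zero_rpow hp0.ne']
          · rw [← Real.rpow_add_one h0.ne', sub_add_cancel]) hS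
      obtain ⟨w, hw, -, hgw⟩ := exists_price hg (v := fun k => c * x k ^ (p - 1))
        fun k _ => mul_nonneg hc.le (Real.rpow_nonneg (hx k) _)
      refine ⟨w, hw, ?_, ?_⟩
      · have e : ∀ k ∈ supp g, (g k * w k) ^ q = (c * x k ^ (p - 1)) ^ q :=
          fun k hk => by rw [hgw k hk]
        rw [sum_congr rfl e, h1]
      · rw [← h2]; exact sum_congr rfl fun k hk => by rw [hgw k hk]
    rcases (sum_nonneg fun k (_ : k ∈ supp g) => Real.rpow_nonneg (hδ k) p).eq_or_lt with h0 | hS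
    -- When the aggregator of `δ` is zero, any admissible price will do.
    · obtain ⟨w, hw, hP, -⟩ := hweights 1 zero_le_one
        (by simpa using (supp_nonempty hg0).card_pos)
      refine ⟨w, hw, hP, ?_⟩
      rw [← h0, Real.zero_rpow (by positivity), mul_zero]
      exact sum_nonneg fun k _ => mul_nonneg (mul_nonneg (hg k) (hw k)) (hδ k)
    · obtain ⟨w, hw, hP, h⟩ := hweights δ hδ hS
      exact ⟨w, hw, hP, h.ge⟩

theorem genDist_one : genDist 1 T z g = fareLovellDist T z g := by
  unfold genDist fareLovellDist
  congr 1
  ext δ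
  rw [phiSum_of_nonneg zero_le_one]
  simp

theorem fareLovellDist_eq_iSup (hT : IsTechnology T) (hz : z ∈ T) (hg : 0 ≤ g) (hg0 : g ≠ 0) :
    fareLovellDist T z g =
      ⨆ (w : Netput m n) (_ : 0 ≤ w)
        (_ : suppCard g * (supp g).sup' (supp_nonempty hg0) (fun k => w k * g k) = 1),
        (profitDir T z g w - ((w ⬝ᵥ z : ℝ) : EReal)) := by
  have hd := suppCard_pos hg0
  refine slackDist_eq_iSup hT hz hg hg0 (fun w hw hP δ hδ => ?_) (fun δ hδ => ?_)
  · rw [mul_sum]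
    refine sum_le_sum fun k hk => mul_le_mul_of_nonneg_right ?_ (hδ k)
    rw [le_div_iff₀ hd, ← hP, mul_comm, mul_comm (g k)]
    exact mul_le_mul_of_nonneg_left (le_sup' (fun k => w k * g k) hk) hd.le
  · obtain ⟨w, hw, -, hgw⟩ := exists_price hg (v := fun _ => 1 / suppCard g)
      fun k _ => (one_div_pos.mpr hd).le
    refine ⟨w, hw, ?_, ?_⟩
    · rw [sup'_congr (supp_nonempty hg0) rfl (fun k hk => (mul_comm _ _).trans (hgw k hk)),
        sup'_const, mul_one_div_cancel hd.ne']
    · rw [mul_sum]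
      exact (sum_congr rfl fun k hk => by rw [hgw k hk]).le

theorem dotProduct_eq_sum_supp (w : Netput m n) : w ⬝ᵥ g = ∑ k ∈ supp g, g k * w k := by
  simpa using dotProduct_slack (z := 0) (g := g) w 1

/-- The numbers `g k * w k` range over a simplex, and a weighted mean of slacks is largest at a
vertex. -/
theorem asymmetricDist_eq_iSup (hT : IsTechnology T) (hz : z ∈ T) (hg : 0 ≤ g) :
    asymmetricDist T z g =
      ⨆ (w : Netput m n) (_ : 0 ≤ w) (_ : w ⬝ᵥ g = 1),
        (profitDir T z g w - ((w ⬝ᵥ z : ℝ) : EReal)) := by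
  classical
  refine le_antisymm (iSup₂_le fun j hj => iSup₂_le fun t ht => ?_)
    (iSup_le fun w => iSup_le fun hw => iSup_le fun hP => profitDir_sub_le hT hg fun δ hδ => ?_)
  · obtain ⟨w, hw, -, hgw⟩ := exists_price hg (v := Pi.single j (1 : ℝ))
      fun k _ => by rw [Pi.single_apply]; split_ifs <;> norm_num
    have hwg : w ⬝ᵥ g = 1 := by
      rw [dotProduct_eq_sum_supp, sum_congr rfl hgw]
      simp [hj]
    refine le_iSup_of_le w <| le_iSup_of_le hw <| le_iSup_of_le hwg ?_
    -- The step `t` may be negative, unlike a slack; `max t 0` is still feasible because `z ∈ T`.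
    have hmem : z + Pi.single j (max t 0) * g ∈ T := by
      have hrw : (Pi.single j (max t 0) : Netput m n) * g = max t 0 • Pi.single j (g j) := by
        ext k
        by_cases hk : k = j
        · subst hk; simp
        · simp [hk]
      rw [hrw]
      rcases le_total t 0 with h | h
      · rw [max_eq_right h, zero_smul, add_zero]; exact hz
      · rw [max_eq_left h]; exact ht
    refine le_trans (EReal.coe_le_coe_iff.mpr ?_) (le_profitDir_sub hg (δ := Pi.single j (max t 0))
      (Pi.single_nonneg.mpr (le_max_right _ _)) hmem)
    have e : ∀ k ∈ supp g, g k * w k * (Pi.single j (max t 0) : Netput m n) k =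
        if k = j then max t 0 else 0 := fun k hk => by
      rw [hgw k hk]
      by_cases h : k = j
      · subst h; simp
      · simp [h]
    rw [sum_congr rfl e, sum_ite_eq', if_pos hj]
    exact le_max_left _ _
  · have hne : (supp g).Nonempty := by
      rw [nonempty_iff_ne_empty]
      intro h
      rw [dotProduct_eq_sum_supp, h, sum_empty] at hP
      exact zero_ne_one hP
    obtain ⟨j, hj, hmax⟩ := (supp g).exists_max_image δ hne
    have hmem : z + δ j • Pi.single j (g j) ∈ T := by
      refine hT.free_disposal _ hδ.2.2 _ (add_le_add_right (fun k => ?_) z)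
      by_cases hk : k = j
      · subst hk; simp
      · simpa [hk] using mul_nonneg (hδ.1 k) (hg k)
    refine le_trans (EReal.coe_le_coe_iff.mpr ?_)
      (le_iSup₂_of_le j hj (le_iSup₂_of_le (δ j) hmem le_rfl))
    calc ∑ k ∈ supp g, g k * w k * δ k ≤ ∑ k ∈ supp g, g k * w k * δ j :=
          sum_le_sum fun k hk =>
            mul_le_mul_of_nonneg_left (hmax k hk) (mul_nonneg (hg k) (hw k))
      _ = δ j := by rw [← sum_mul, ← dotProduct_eq_sum_supp, hP, one_mul]

theorem multDist_eq_iInf (hT : IsTechnology T) (hconv : Convex ℝ T) (hz : z ∈ T) (hg : 0 ≤ g)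
    (hg0 : g ≠ 0) :
    multDist T z g =
      ⨅ (w : Netput m n) (_ : 0 ≤ w)
        (_ : suppCard g * ∏ k ∈ supp g, (g k * w k) ^ (1 / suppCard g) = 1),
        (profit T z w - ((w ⬝ᵥ z : ℝ) : EReal)) := by
  have hd := suppCard_pos hg0
  have hdd : ∑ _k ∈ supp g, 1 / suppCard g = 1 := by
    rw [sum_const, nsmul_eq_mul]
    exact mul_one_div_cancel hd.ne'
  refine slackDist_eq_iInf 0 hT hconv hz hg hg0 ?_ (fun w hw hP δ hδ => ?_) (fun x hx => ?_)
  · exact (continuous_finsetProd _ fun k _ => (continuous_apply k).rpow_const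
      fun _ => Or.inr (by positivity)).continuousOn
  · have h := Real.geom_mean_le_arith_mean_weighted (supp g) (fun _ => 1 / suppCard g)
      (fun k => g k * w k * δ k) (fun k _ => by positivity) hdd
      (fun k _ => mul_nonneg (mul_nonneg (hg k) (hw k)) (hδ k))
    rw [← mul_sum, prod_congr rfl fun k _ =>
      Real.mul_rpow (mul_nonneg (hg k) (hw k)) (hδ k), prod_mul_distrib] at h
    have h2 := mul_le_mul_of_nonneg_left h hd.le
    rwa [← mul_assoc, hP, one_mul, ← mul_assoc, mul_one_div_cancel hd.ne', one_mul] at h2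
  · have hG : 0 < ∏ k ∈ supp g, x k ^ (1 / suppCard g) :=
      prod_pos fun k _ => Real.rpow_pos_of_pos (hx k) _
    set G := ∏ k ∈ supp g, x k ^ (1 / suppCard g) with hGdef
    have hc : 0 < G / suppCard g := div_pos hG hd
    -- The equality case of AM-GM: all products `g k * w k * x k` equal `G / suppCard g`.
    refine ⟨G / suppCard g, hc, ?_, fun w hw => ?_⟩
    · have e : ∀ k ∈ supp g, G / suppCard g * x k ^ ((0 : ℝ) - 1) * x k = G * (1 / suppCard g) :=
        fun k _ => by
          rw [mul_assoc, ← Real.rpow_add_one (hx k).ne', sub_add_cancel, Real.rpow_zero, mul_one,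
            mul_one_div]
      rw [sum_congr rfl e, ← mul_sum, hdd, mul_one]
    · have e : ∀ k ∈ supp g, (g k * w k) ^ (1 / suppCard g) =
          (G / suppCard g) ^ (1 / suppCard g) * (x k ^ (1 / suppCard g))⁻¹ := fun k hk => by
        rw [hw k hk, Real.mul_rpow hc.le (Real.rpow_nonneg (hx k).le _), zero_sub,
          Real.rpow_neg_one, Real.inv_rpow (hx k).le]
      rw [prod_congr rfl e, prod_mul_distrib, prod_inv_distrib, ← hGdef,
        ← Real.rpow_sum_of_pos hc, hdd, Real.rpow_one]
      field_simp

theorem genDist_eq_iInf (hT : IsTechnology T) (hconv : Convex ℝ T) (hz : z ∈ T) (hg : 0 ≤ g)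
    (hg0 : g ≠ 0) {p q : ℝ} (hp : p < 1) (hp0 : p ≠ 0) (hpq : 1 / p + 1 / q = 1) :
    genDist p T z g =
      ⨅ (w : Netput m n) (_ : 0 ≤ w)
        (_ : suppCard g ^ ((q - 1) / q) * phiSum q (supp g) (fun k => g k * w k) = 1),
        (profit T z w - ((w ⬝ᵥ z : ℝ) : EReal)) := by
  have hd := suppCard_pos hg0
  have hK := supp_nonempty hg0
  -- With `1 / 0 = 0`, the value `q = 0` would force `p = 1`.
  have hq0 : q ≠ 0 := by
    rintro rfl
    rw [div_zero, add_zero, div_eq_one_iff_eq hp0] at hpq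
    exact hp.ne' hpq
  have hqp : (q - 1) / q = 1 / p := by rw [sub_div, div_self hq0]; linarith
  have hdp := Real.rpow_pos_of_pos hd (1 / p)
  refine slackDist_eq_iInf p hT hconv hz hg hg0 (continuousOn_const.mul
    (continuousOn_phiSum hp0 hK)) (fun w hw hP δ hδ => ?_) (fun x hx => ?_)
  · rw [hqp] at hP
    have h := phiSum_mul_phiSum_le hp hp0 hpq hK (v := fun k => g k * w k) (x := δ)
      (fun k _ => mul_nonneg (hg k) (hw k)) (fun k _ => hδ k)
    rwa [eq_div_of_mul_eq hdp.ne' ((mul_comm _ _).trans hP), mul_comm] at h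
  · obtain ⟨c, hc, h1, h2⟩ := exists_dual_weight (K := supp g) hd hp0 hq0 hpq
      (fun k _ => (hx k).le)
      (fun k _ => by rw [← Real.rpow_add_one (hx k).ne', sub_add_cancel])
      (sum_pos (fun k _ => Real.rpow_pos_of_pos (hx k) _) hK)
    refine ⟨c, hc, ?_, fun w hw => ?_⟩
    · rw [h2, phiSum_of_pos fun k _ => hx k]
    · rw [phiSum_of_pos fun k hk => by
        rw [hw k hk]; exact mul_pos hc (Real.rpow_pos_of_pos (hx k) _)]
      have e : ∀ k ∈ supp g, (g k * w k) ^ q = (c * x k ^ (p - 1)) ^ q :=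
        fun k hk => by rw [hw k hk]
      rw [sum_congr rfl e, h1]

theorem directionalDist_eq_iInf (hT : IsTechnology T) (hconv : Convex ℝ T) (hz : z ∈ T)
    (hg : 0 ≤ g) (hg0 : g ≠ 0) :
    directionalDist T z g =
      ⨅ (w : Netput m n) (_ : 0 ≤ w) (_ : w ⬝ᵥ g = 1),
        (profit T z w - ((w ⬝ᵥ z : ℝ) : EReal)) := by
  classical
  refine le_antisymm (iSup₂_le fun t ht =>
    le_iInf fun w => le_iInf fun hw => le_iInf fun hP => ?_) ?_
  · have hmem : z + (fun _ => max t 0) * g ∈ T := by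
      have hrw : (fun _ => max t 0) * g = max t 0 • g := by ext k; simp
      rw [hrw]
      rcases le_total t 0 with h | h
      · rw [max_eq_right h, zero_smul, add_zero]; exact hz
      · rw [max_eq_left h]; exact ht
    refine le_trans (EReal.coe_le_coe_iff.mpr ?_)
      (le_profit_sub hg (δ := fun _ => max t 0) (fun _ => le_max_right _ _) hmem)
    rw [← sum_mul, ← dotProduct_eq_sum_supp, hP, one_mul]
    exact le_max_left _ _
  · refine EReal.le_of_forall_lt_iff_le.mp fun t ht => ?_
    obtain ⟨s, hs, hst⟩ := EReal.lt_iff_exists_real_btwn.mp ht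
    rw [EReal.coe_lt_coe_iff] at hst
    obtain ⟨v, hv, hv1, hvle⟩ := exists_weight_of_no_dominating (K := supp g)
      (convex_slackSet hconv) (zero_mem_slackSet (g := g) hz) (fun x hx => hx.2.1) hst
      -- Slacks all above `s` would, by free disposal down to their minimum, give a common step
      -- longer than the distance.
      (fun x hx => by
        by_contra! h
        obtain ⟨j, hj, hmin⟩ := (supp g).exists_min_image x (supp_nonempty hg0)
        have hmem : z + x j • g ∈ T := by
          refine hT.free_disposal _ hx.2.2 _ (add_le_add_right (fun k => ?_) z)
          by_cases hk : k ∈ supp g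
          · exact mul_le_mul_of_nonneg_right (hmin k hk) (hg k)
          · simp [not_not.mp (mem_supp.not.mp hk)]
        have hle : ((x j : ℝ) : EReal) ≤ directionalDist T z g := le_iSup₂_of_le (x j) hmem le_rfl
        exact (h j hj).not_ge (EReal.coe_le_coe_iff.mp (hle.trans hs.le)))
    obtain ⟨w, hw, hw0, hgw⟩ := exists_price hg (v := v) fun k _ => hv k
    have hP : w ⬝ᵥ g = 1 := by rw [dotProduct_eq_sum_supp, sum_congr rfl hgw, hv1]
    refine iInf_le_of_le w <| iInf_le_of_le hw <| iInf_le_of_le hP <|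
      profit_sub_le hT hg hw0 fun δ hδ => EReal.coe_le_coe_iff.mpr ?_
    rw [sum_congr rfl fun k hk => by rw [hgw k hk]]
    exact hvle δ hδ

end Duality

end NetputDuality

theorem proposition13 {m n : ℕ} (T : Set (Netput m n)) (hT : IsTechnology T)
    (z : Netput m n) (hz : z ∈ T) (g : Netput m n) (hg_nonneg : 0 ≤ g) (hg : g ≠ 0) :
    -- (a) `1 < p < ∞`
    (∀ p q : ℝ, 1 < p → 1 / p + 1 / q = 1 →
      genDist p T z g =
        ⨆ (w : Netput m n) (_ : 0 ≤ w)
          (_ : suppCard g ^ ((q - 1) / q) * (∑ k ∈ supp g, (g k * w k) ^ q) ^ (1 / q) = 1),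
          (profitDir T z g w - ((w ⬝ᵥ z : ℝ) : EReal))) ∧
    -- (b) `p = 1`
    (genDist 1 T z g = fareLovellDist T z g ∧
      fareLovellDist T z g =
        ⨆ (w : Netput m n) (_ : 0 ≤ w)
          (_ : suppCard g * (supp g).sup' (supp_nonempty hg) (fun k => w k * g k) = 1),
          (profitDir T z g w - ((w ⬝ᵥ z : ℝ) : EReal))) ∧
    -- (c) `p = ∞`
    (asymmetricDist T z g =
      ⨆ (w : Netput m n) (_ : 0 ≤ w) (_ : w ⬝ᵥ g = 1),
        (profitDir T z g w - ((w ⬝ᵥ z : ℝ) : EReal))) ∧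
    (Convex ℝ T →
      -- (d) `p = 0`
      (multDist T z g =
        ⨅ (w : Netput m n) (_ : 0 ≤ w)
          (_ : suppCard g * ∏ k ∈ supp g, (g k * w k) ^ (1 / suppCard g) = 1),
          (profit T z w - ((w ⬝ᵥ z : ℝ) : EReal))) ∧
      -- (e) `p < 1`, `p ≠ 0`
      (∀ p q : ℝ, p < 1 → p ≠ 0 → 1 / p + 1 / q = 1 →
        genDist p T z g =
          ⨅ (w : Netput m n) (_ : 0 ≤ w)
            (_ : suppCard g ^ ((q - 1) / q) * phiSum q (supp g) (fun k => g k * w k) = 1),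
            (profit T z w - ((w ⬝ᵥ z : ℝ) : EReal))) ∧
      -- (f) `p = -∞`
      (directionalDist T z g =
        ⨅ (w : Netput m n) (_ : 0 ≤ w) (_ : w ⬝ᵥ g = 1),
          (profit T z w - ((w ⬝ᵥ z : ℝ) : EReal)))) := by
  exact ⟨fun p q hp hpq => genDist_eq_iSup hT hz hg_nonneg hg hp hpq,
    ⟨genDist_one, fareLovellDist_eq_iSup hT hz hg_nonneg hg⟩,
    asymmetricDist_eq_iSup hT hz hg_nonneg,
    fun hconv => ⟨multDist_eq_iInf hT hconv hz hg_nonneg hg,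
      fun p q hp hp0 hpq => genDist_eq_iInf hT hconv hz hg_nonneg hg hp hp0 hpq,
      directionalDist_eq_iInf hT hconv hz hg_nonneg hg⟩⟩
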